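/- Let $M$ be a connected, closed (compact, without boundary), smooth Riemannian manifold with Riemannian distance $d$, and let $|\cdot|$ denote the norm on each $T_x^*M$ dual to the Riemannian norm on $T_xM$. Let $H=H(x,p,u)$ be a real-valued function on $T^*M\times\mathbb R$ such that - (H1) $H$ is continuous on $T^*M\times\mathbb R$; - (H2) for every $R>0$ there is $K>0$ such that $H(x,p,u)>R$ whenever $|u|\le R$ and $|p|\ge K$; - (H3) $p\mapsto H(x,p,u)$ is convex on $T_x^*M$ for all $(x,u)\in M\times\mathbb R$; - (H4) there is a constant $\Lambda>0$, fixed in what follows, such that $|H(x,p,u)-H(x,p,v)|\le\Lambda|u-v|$ for all $(x,p)\in T^*M$ and $u,v\in\mathbb R$. A lower semicontinuous function $u:M\times[0,\infty)\to\mathbb R\cup\{\infty\}$ is called a Barron–Jensen (BJ) solution of the Cauchy problem $$u_t+H(x,D_xu,u)=0\ \text{ in } M\times(0,\infty),\qquad u(\cdot,0)=\phi_0$$ if, whenever $\varphi\in C^1(M\times(0,\infty),\mathbb R)$ and $u-\varphi$ attains its minimum over $M\times(0,\infty)$ at a point $(x,t)$ with $u(x,t)<\infty$, one has $\varphi_t(x,t)+H(x,D_x\varphi(x,t),u(x,t))=0$,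 and if $\phi_0(x)=u(x,0)=\liminf_{t\to0+}u(x,t)$ for all $x\in M$. For $y\in M$, let $h(\cdot,\cdot,y,0)$ denote the fundamental solution with pole $y$, that is, the BJ solution of the Cauchy problem with initial datum $0$ at $y$ and $+\infty$ on $M\setminus\{y\}$. Then there exist constants $\delta>0$ and $C>0$ such that, for all $x,y\in M$ and $t\ge0$, $$h(x,t,y,0)\ \ge\ -C\,(e^{\Lambda t}-1),$$ $$h(x,t,y,0)\ \le\ C\,(e^{\Lambda t}-1)\qquad\text{if } d(x,y)\le\delta t .$$ -/

import Mathlib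

open Set Filter Topology Manifold
open scoped ContDiff Bundle

noncomputable section

/-- The cotangent space `T*_x M`. When the tangent spaces carry a Riemannian metric, its norm is the
norm dual to the Riemannian norm: `|p| = sup {⟨p, v⟩ : |v| ≤ 1}`. -/
abbrev CotangentSpace (n : ℕ) {M : Type*} [TopologicalSpace M]
    [ChartedSpace (EuclideanSpace ℝ (Fin n)) M] (x : M) : Type :=
  TangentSpace (𝓡 n) x →L[ℝ] ℝ

/-- The cotangent bundle `T*M`, with its vector bundle topology. -/
abbrev CotangentBundle (n : ℕ) (M : Type*) [TopologicalSpace M]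
    [ChartedSpace (EuclideanSpace ℝ (Fin n)) M] : Type _ :=
  Bundle.TotalSpace (EuclideanSpace ℝ (Fin n) →L[ℝ] ℝ) (fun x : M => CotangentSpace n x)

section Hamiltonian

variable {n : ℕ} {M : Type*} [TopologicalSpace M] [ChartedSpace (EuclideanSpace ℝ (Fin n)) M]

/-- The differential `D_x φ(x, t) ∈ T*_x M` of `φ(·, t)` at `x`. -/
def spaceDifferential (n : ℕ) {M : Type*} [TopologicalSpace M]
    [ChartedSpace (EuclideanSpace ℝ (Fin n)) M] (φ : M × ℝ → ℝ) (x : M) (t : ℝ) :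
    CotangentSpace n x :=
  mfderiv (𝓡 n) 𝓘(ℝ, ℝ) (fun z : M => φ (z, t)) x

/-- The time derivative `φ_t(x, t)`. -/
def timeDerivative {M : Type*} (φ : M × ℝ → ℝ) (x : M) (t : ℝ) : ℝ :=
  deriv (fun s : ℝ => φ (x, s)) t

/-- `φ` is a test function on `M × (0, ∞)`: it is of class `C¹` there (its values at times `t ≤ 0`
are irrelevant). -/
def IsTestFunction (n : ℕ) {M : Type*} [TopologicalSpace M]
    [ChartedSpace (EuclideanSpace ℝ (Fin n)) M] (φ : M × ℝ → ℝ) : Prop :=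
  ContMDiffOn ((𝓡 n).prod 𝓘(ℝ, ℝ)) 𝓘(ℝ, ℝ) 1 φ (univ ×ˢ Ioi (0 : ℝ))

/-- `u - φ`, over `M × (0, ∞)`, attains its minimum at `(x, t)`. -/
def TouchesFromBelow {M : Type*} (u : M → ℝ → EReal) (φ : M × ℝ → ℝ) (x : M) (t : ℝ) : Prop :=
  ∀ z : M, ∀ s : ℝ, 0 < s → u x t - (φ (x, t) : EReal) ≤ u z s - (φ (z, s) : EReal)

/-- `u : M × [0, ∞) → ℝ ∪ {∞}` is lower semicontinuous. The values of `u` at times `t < 0` are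
irrelevant. -/
def IsLSCExtendedReal {M : Type*} [TopologicalSpace M] (u : M → ℝ → EReal) : Prop :=
  (∀ x : M, ∀ t : ℝ, 0 ≤ t → u x t ≠ ⊥) ∧
    LowerSemicontinuousOn (fun q : M × ℝ => u q.1 q.2) (univ ×ˢ Ici (0 : ℝ))

/-- The subsolution inequality of `u_t + H(x, D_x u, u) = 0` in `M × (0, ∞)` in the sense of lower
semicontinuous viscosity (Barron–Jensen) solutions: test functions touch `u` from below, at points
where `u` is finite. -/
def IsBJSubsolution (H : CotangentBundle n M → ℝ → ℝ) (u : M → ℝ → EReal) : Prop :=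
  ∀ φ : M × ℝ → ℝ, IsTestFunction n φ → ∀ x : M, ∀ t : ℝ, 0 < t → ∀ r : ℝ, u x t = (r : EReal) →
    TouchesFromBelow u φ x t →
      timeDerivative φ x t + H ⟨x, spaceDifferential n φ x t⟩ r ≤ 0

/-- The supersolution inequality of `u_t + H(x, D_x u, u) = 0` in `M × (0, ∞)`. -/
def IsBJSupersolution (H : CotangentBundle n M → ℝ → ℝ) (u : M → ℝ → EReal) : Prop :=
  ∀ φ : M × ℝ → ℝ, IsTestFunction n φ → ∀ x : M, ∀ t : ℝ, 0 < t → ∀ r : ℝ, u x t = (r : EReal) →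
    TouchesFromBelow u φ x t →
      0 ≤ timeDerivative φ x t + H ⟨x, spaceDifferential n φ x t⟩ r

/-- `u` is a Barron–Jensen solution of the Cauchy problem `u_t + H(x, D_x u, u) = 0` in
`M × (0, ∞)`, `u(·, 0) = φ₀`. The initial condition reads
`φ₀(x) = u(x, 0) = liminf_{t → 0+} u(x, t)` for every `x`. -/
structure IsBJCauchySolution (H : CotangentBundle n M → ℝ → ℝ) (φ₀ : M → EReal)
    (u : M → ℝ → EReal) : Prop where
  lsc : IsLSCExtendedReal u
  subsolution : IsBJSubsolution H u
  supersolution : IsBJSupersolution H u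
  initial_value : ∀ x : M, u x 0 = φ₀ x
  initial_liminf : ∀ x : M, liminf (fun t : ℝ => u x t) (𝓝[>] (0 : ℝ)) = φ₀ x

open Classical in
/-- The initial datum with value `c` at `y` and `∞` elsewhere. -/
def pointDatum {M : Type*} (y : M) (c : EReal) (x : M) : EReal :=
  if x = y then c else ⊤

/-- `h = h(·, ·, y, c)` is the fundamental solution of `u_t + H(x, D_x u, u) = 0` with pole `y` and
value `c`: the Barron–Jensen solution whose initial datum is `c` at `y` and `∞` elsewhere. -/
def IsFundamentalSolution (H : CotangentBundle n M → ℝ → ℝ) (y : M) (c : EReal)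
    (h : M → ℝ → EReal) : Prop :=
  IsBJCauchySolution H (pointDatum y c) h

/-- The standing assumptions on the Hamiltonian, with a fixed Lipschitz bound `Λ` in `u`. -/
structure IsAdmissibleHamiltonian [IsManifold (𝓡 n) ∞ M]
    [Bundle.RiemannianBundle (fun x : M => TangentSpace (𝓡 n) x)]
    (H : CotangentBundle n M → ℝ → ℝ) (Λ : ℝ) : Prop where
  continuous : Continuous fun q : CotangentBundle n M × ℝ => H q.1 q.2
  coercive : ∀ R : ℝ, 0 < R → ∃ K : ℝ, 0 < K ∧ ∀ (x : M) (p : CotangentSpace n x) (u : ℝ),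
    |u| ≤ R → K ≤ ‖p‖ → R < H ⟨x, p⟩ u
  convex : ∀ (x : M) (u : ℝ), ConvexOn ℝ univ fun p : CotangentSpace n x => H ⟨x, p⟩ u
  lipschitz_pos : 0 < Λ
  lipschitz : ∀ (x : M) (p : CotangentSpace n x) (u v : ℝ),
    |H ⟨x, p⟩ u - H ⟨x, p⟩ v| ≤ Λ * |u - v|

end Hamiltonian

end

/-! ### Localization of test functions -/

section TestFunctions

/-! Both bounds are comparisons with solutions of linear ODEs, made by pushing smooth functions up
under `h` until they touch; in the Barron–Jensen notion even the subsolution inequality is tested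
from below.

Lower bound (`IsBJSupersolution.lower_bound`): `w(t) = -C(e^{Λt} - 1)` satisfies `w' + Λ(C + |w|) =
0`, and `H(x,0,w) ≤ Λ(C + |w|)` once `H(x,0,0) ≤ ΛC`. So `w` is a classical subsolution lying below
`h` at time `0`.

Upper bound: convexity and coercivity give `H ≥ δ|p| - B - Λ|u|` in charts
(`IsAdmissibleHamiltonian.exists_linear_le`). Formally, along a curve `γ` of speed less than `δ`,
`d/ds u(γ(s),s) ≤ -H + δ|Du| ≤ B + Λ|u|`, so an upper bound `A` becomes `(A + C)e^{Λτ} - C` after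
time `τ`. `IsBJSubsolution.le_along_segment` makes this rigorous in one chart by means of a
paraboloid moving along a segment. Compactness makes the constants uniform, and chains of short
steps along almost minimal paths reach all pairs of points (`PropagatesUpperBounds.of_local`).
Starting at the pole at a small time when `h(y,s) < ε`, then letting `s` and `ε` tend to `0`, gives
the claim (`IsFundamentalSolution.upper_bound`). -/

theorem Filter.EventuallyEq.spaceDifferential_eq {n : ℕ} {M : Type*} [TopologicalSpace M]
    [ChartedSpace (EuclideanSpace ℝ (Fin n)) M] {φ ψ : M × ℝ → ℝ} {x : M} {t : ℝ}
    (h : ψ =ᶠ[𝓝 (x, t)] φ) : spaceDifferential n ψ x t = spaceDifferential n φ x t := by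
  have h' : (fun z : M => ψ (z, t)) =ᶠ[𝓝 x] fun z : M => φ (z, t) :=
    (Continuous.prodMk_left t).continuousAt.eventually h
  exact h'.mfderiv_eq

theorem Filter.EventuallyEq.timeDerivative_eq {M : Type*} [TopologicalSpace M] {φ ψ : M × ℝ → ℝ} {x : M} {t : ℝ}
    (h : ψ =ᶠ[𝓝 (x, t)] φ) : timeDerivative ψ x t = timeDerivative φ x t := by
  have h' : (fun s : ℝ => ψ (x, s)) =ᶠ[𝓝 t] fun s : ℝ => φ (x, s) :=
    (Continuous.prodMk_right x).continuousAt.eventually h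
  exact h'.deriv_eq

variable {n : ℕ} {M : Type*} [MetricSpace M] [CompactSpace M]
    [ChartedSpace (EuclideanSpace ℝ (Fin n)) M] [IsManifold (𝓡 n) ∞ M]

/-- A `C¹` function defined near `(x, t)` that touches `u` from below at `(x, t)` agrees near
`(x, t)` with a global test function that touches `u` from below at `(x, t)`. -/
theorem exists_isTestFunction_touchesFromBelow {u : M → ℝ → EReal} (hu : IsLSCExtendedReal u)
    {φ : M × ℝ → ℝ} {x : M} {t : ℝ} {r : ℝ} (hr : u x t = (r : EReal))
    {W : Set (M × ℝ)} (hW : W ∈ 𝓝 (x, t))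
    (hφ : ContMDiffOn ((𝓡 n).prod 𝓘(ℝ, ℝ)) 𝓘(ℝ, ℝ) 1 φ W)
    (hle : ∀ p ∈ W, (φ p : EReal) ≤ u p.1 p.2) (h0 : φ (x, t) = r) :
    ∃ ψ : M × ℝ → ℝ, IsTestFunction n ψ ∧ TouchesFromBelow u ψ x t ∧ ψ =ᶠ[𝓝 (x, t)] φ := by
  obtain ⟨V, hV, hVc, hVW⟩ := exists_mem_nhds_isClosed_subset (interior_mem_nhds.2 hW)
  -- Both constraints, lying below `u` at positive times and agreeing with `φ` on `V`, are convex,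
  -- so local solutions glue by a partition of unity. Near a point outside `interior W`, which has a
  -- neighbourhood missing the closed set `V`, a constant below `u` serves.
  let S : M × ℝ → Set ℝ := fun p => {y : ℝ | 0 < p.2 → (y : EReal) ≤ u p.1 p.2} ∩
    {y : ℝ | p ∈ V → y = φ p}
  have hS : ∀ p, Convex ℝ (S p) := by
    intro p
    refine OrdConnected.convex ⟨?_⟩
    rintro a ⟨ha, ha'⟩ b ⟨hb, hb'⟩ y ⟨hy1, hy2⟩
    refine ⟨fun h => (EReal.coe_le_coe_iff.2 hy2).trans (hb h), fun h => ?_⟩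
    exact le_antisymm (hy2.trans_eq (hb' h)) ((ha' h).symm.trans_le hy1)
  have : IsManifold (𝓡 n) 1 M := IsManifold.of_le (n := ∞) (by simp)
  obtain ⟨ψ, hψ⟩ := exists_contMDiffMap_forall_mem_convex_of_local (n := 1)
    ((𝓡 n).prod 𝓘(ℝ, ℝ)) (t := S) hS (by
      intro p
      by_cases hp : p ∈ interior W
      · refine ⟨interior W, isOpen_interior.mem_nhds hp, φ, hφ.mono interior_subset, ?_⟩
        exact fun q hq => ⟨fun _ => hle q (interior_subset hq), fun _ => rfl⟩
      have hpV : Vᶜ ∈ 𝓝 p := hVc.isOpen_compl.mem_nhds fun h => hp (hVW h)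
      obtain ⟨c, hc⟩ : ∃ c : ℝ, ∀ᶠ q in 𝓝 p, 0 < q.2 → (c : EReal) ≤ u q.1 q.2 := by
        rcases lt_or_ge p.2 0 with h | h
        · refine ⟨0, ?_⟩
          filter_upwards [continuous_snd.continuousAt.eventually (gt_mem_nhds h)] with q hq hq'
          exact absurd hq (not_lt.2 (le_of_lt hq'))
        · obtain ⟨c, -, hc⟩ := EReal.lt_iff_exists_real_btwn.1
            (bot_lt_iff_ne_bot.2 (hu.1 p.1 p.2 h))
          refine ⟨c, ?_⟩
          have := hu.2 p ⟨mem_univ _, h⟩ c hc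
          rw [eventually_nhdsWithin_iff] at this
          filter_upwards [this] with q hq hq'
          exact (hq ⟨mem_univ _, hq'.le⟩).le
      refine ⟨_, inter_mem hpV hc, fun _ => c, contMDiffOn_const, ?_⟩
      exact fun q hq => ⟨hq.2, fun h => absurd h hq.1⟩)
  refine ⟨ψ, ψ.contMDiff.contMDiffOn, ?_, ?_⟩
  · intro z s hs
    have h1 : ψ (x, t) = r := ((hψ (x, t)).2 (mem_of_mem_nhds hV)).trans h0
    have h2 : (ψ (z, s) : EReal) ≤ u z s := (hψ (z, s)).1 hs
    rw [hr, h1, EReal.sub_self (EReal.coe_ne_top r) (EReal.coe_ne_bot r)]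
    exact (EReal.sub_nonneg (.inr (EReal.coe_ne_top _)) (.inr (EReal.coe_ne_bot _))).2 h2
  · filter_upwards [hV] with p hp using (hψ p).2 hp

/-- The subsolution inequality for test functions that are only defined locally. -/
theorem IsBJSubsolution.le_zero_of_local {H : CotangentBundle n M → ℝ → ℝ} {u : M → ℝ → EReal}
    (hsub : IsBJSubsolution H u) (hu : IsLSCExtendedReal u)
    {φ : M × ℝ → ℝ} {x : M} {t : ℝ} (ht : 0 < t) {r : ℝ} (hr : u x t = (r : EReal))
    {W : Set (M × ℝ)} (hW : W ∈ 𝓝 (x, t))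
    (hφ : ContMDiffOn ((𝓡 n).prod 𝓘(ℝ, ℝ)) 𝓘(ℝ, ℝ) 1 φ W)
    (hle : ∀ p ∈ W, (φ p : EReal) ≤ u p.1 p.2) (h0 : φ (x, t) = r) :
    timeDerivative φ x t + H ⟨x, spaceDifferential n φ x t⟩ r ≤ 0 := by
  obtain ⟨ψ, h1, h2, h3⟩ := exists_isTestFunction_touchesFromBelow hu hr hW hφ hle h0
  rw [← h3.spaceDifferential_eq, ← h3.timeDerivative_eq]
  exact hsub ψ h1 x t ht r hr h2

/-- The supersolution inequality for test functions that are only defined locally. -/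
theorem IsBJSupersolution.zero_le_of_local {H : CotangentBundle n M → ℝ → ℝ} {u : M → ℝ → EReal}
    (hsuper : IsBJSupersolution H u) (hu : IsLSCExtendedReal u)
    {φ : M × ℝ → ℝ} {x : M} {t : ℝ} (ht : 0 < t) {r : ℝ} (hr : u x t = (r : EReal))
    {W : Set (M × ℝ)} (hW : W ∈ 𝓝 (x, t))
    (hφ : ContMDiffOn ((𝓡 n).prod 𝓘(ℝ, ℝ)) 𝓘(ℝ, ℝ) 1 φ W)
    (hle : ∀ p ∈ W, (φ p : EReal) ≤ u p.1 p.2) (h0 : φ (x, t) = r) :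
    0 ≤ timeDerivative φ x t + H ⟨x, spaceDifferential n φ x t⟩ r := by
  obtain ⟨ψ, h1, h2, h3⟩ := exists_isTestFunction_touchesFromBelow hu hr hW hφ hle h0
  rw [← h3.spaceDifferential_eq, ← h3.timeDerivative_eq]
  exact hsuper ψ h1 x t ht r hr h2

end TestFunctions

/-! ### Touching a lower semicontinuous function from below -/

section Minimization

variable {X : Type*} [TopologicalSpace X]

theorem LowerSemicontinuousOn.exists_real_le {u : X → EReal} {D : Set X} (hD : IsCompact D)
    (hu : LowerSemicontinuousOn u D) (hbot : ∀ p ∈ D, u p ≠ ⊥) :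
    ∃ L : ℝ, ∀ p ∈ D, (L : EReal) ≤ u p := by
  rcases D.eq_empty_or_nonempty with rfl | hne
  · exact ⟨0, by simp⟩
  obtain ⟨p, hp, hmin⟩ := hu.exists_isMinOn hne hD
  obtain ⟨L, -, hL⟩ := EReal.lt_iff_exists_real_btwn.1 (bot_lt_iff_ne_bot.2 (hbot p hp))
  exact ⟨L, fun q hq => hL.le.trans (hmin hq)⟩

/-- If a lower semicontinuous `u` is somewhere below `ψ` on a compact set, then some
`ψ - N g` with `N > 0` touches `u` from below on this set. -/
theorem LowerSemicontinuousOn.exists_touching {u : X → EReal} {D : Set X} (hD : IsCompact D)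
    (hu : LowerSemicontinuousOn u D) (hbot : ∀ p ∈ D, u p ≠ ⊥) {ψ g : X → ℝ}
    (hψ : ContinuousOn ψ D) (hg : ContinuousOn g D) (hg0 : ∀ p ∈ D, 0 < g p)
    {p₀ : X} (hp₀ : p₀ ∈ D) (hlt : u p₀ < (ψ p₀ : EReal)) :
    ∃ p ∈ D, ∃ N : ℝ, 0 < N ∧ u p = ((ψ p - N * g p : ℝ) : EReal) ∧
      ∀ q ∈ D, ((ψ q - N * g q : ℝ) : EReal) ≤ u q := by
  obtain ⟨K, hK⟩ := (hD.image_of_continuousOn hψ).bddAbove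
  have hK' : ∀ q ∈ D, ψ q ≤ K := fun q hq => hK (mem_image_of_mem _ hq)
  -- Truncation at an upper bound `K` of `ψ` makes `u` real-valued. The number `-N` will be the
  -- minimum of `(v - ψ) / g`; it is negative, so `v < ψ ≤ K` at the minimizer and the truncation is
  -- inactive there.
  let v : X → ℝ := fun q => (min (u q) (K : EReal)).toReal
  have hv : ∀ q ∈ D, (v q : EReal) = min (u q) (K : EReal) := by
    intro q hq
    refine EReal.coe_toReal ?_ ?_
    · exact ne_top_of_le_ne_top (EReal.coe_ne_top K) (min_le_right _ _)
    · rw [ne_eq, min_eq_bot, not_or]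
      exact ⟨hbot q hq, EReal.coe_ne_bot K⟩
  let f : X → ℝ := fun q => (v q - ψ q) / g q
  have hf : LowerSemicontinuousOn f D := by
    intro q hq y hy
    have hy' : y * g q + ψ q < v q := by
      have := (lt_div_iff₀ (hg0 q hq)).1 hy
      linarith
    obtain ⟨c, hc1, hc2⟩ := exists_between hy'
    have hc3 : (c : EReal) < min (u q) (K : EReal) := by
      rw [← hv q hq]; exact_mod_cast hc2
    have h1 := hu q hq c (hc3.trans_le (min_le_left _ _))
    have h2 : ∀ᶠ q' in 𝓝[D] q, y * g q' + ψ q' < c :=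
      ((continuousWithinAt_const.mul (hg q hq)).add (hψ q hq)).eventually (gt_mem_nhds hc1)
    filter_upwards [h1, h2, self_mem_nhdsWithin] with q' h1' h2' h3'
    have h4 : (c : EReal) < (v q' : EReal) := by
      rw [hv q' h3']
      exact lt_min h1' (hc3.trans_le (min_le_right _ _))
    have h5 : c < v q' := by exact_mod_cast h4
    exact (lt_div_iff₀ (hg0 q' h3')).2 (by linarith)
  obtain ⟨p, hp, hmin⟩ := hf.exists_isMinOn ⟨p₀, hp₀⟩ hD
  have hvlt : v p₀ < ψ p₀ := by
    have : (v p₀ : EReal) < (ψ p₀ : EReal) := by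
      rw [hv p₀ hp₀]; exact (min_le_left _ _).trans_lt hlt
    exact_mod_cast this
  have hm : f p < 0 :=
    (hmin hp₀ : f p ≤ f p₀).trans_lt (div_neg_of_neg_of_pos (by linarith) (hg0 p₀ hp₀))
  have hle : ∀ q ∈ D, ψ q - -f p * g q ≤ v q := by
    intro q hq
    have : f p * g q ≤ v q - ψ q := (le_div_iff₀ (hg0 q hq)).1 (hmin hq)
    linarith
  refine ⟨p, hp, -f p, by linarith, ?_, fun q hq => ?_⟩
  · have h1 : v p = ψ p - -f p * g p := by
      have : f p * g p = v p - ψ p := div_mul_cancel₀ _ (hg0 p hp).ne'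
      linarith
    have h2 : v p < K := by
      have := mul_neg_of_neg_of_pos hm (hg0 p hp)
      linarith [hK' p hp]
    rw [← h1, hv p hp]
    have h3 : min (u p) (K : EReal) < K := by
      rw [← hv p hp]; exact_mod_cast h2
    rcases min_lt_iff.1 h3 with h4 | h4
    · exact (min_eq_left h4.le).symm
    · exact absurd h4 (lt_irrefl _)
  · refine le_trans ?_ ((hv q hq).le.trans (min_le_left _ _))
    exact_mod_cast hle q hq

end Minimization

/-! ### The lower bound -/

section LowerBound

variable {n : ℕ} {M : Type*} [MetricSpace M] [CompactSpace M]
    [ChartedSpace (EuclideanSpace ℝ (Fin n)) M] [IsManifold (𝓡 n) ∞ M]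

/-- If `u` dropped below `w(s) = -C(e^{Λs} - 1)`, some `w - N e^{μs}` with `μ > Λ` would touch `u`
from below at an interior time. The penalty makes it a strict subsolution, which contradicts the
supersolution inequality. -/
theorem IsBJSupersolution.lower_bound {H : CotangentBundle n M → ℝ → ℝ} {u : M → ℝ → EReal}
    (hsuper : IsBJSupersolution H u) (hu : IsLSCExtendedReal u) {Λ C : ℝ} (hΛ : 0 < Λ)
    (hC : 0 < C)
    (hlip : ∀ (x : M) (p : CotangentSpace n x) (u v : ℝ), |H ⟨x, p⟩ u - H ⟨x, p⟩ v| ≤ Λ * |u - v|)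
    (hH0 : ∀ x : M, H ⟨x, 0⟩ 0 ≤ Λ * C) (h0 : ∀ x : M, 0 ≤ u x 0) (x : M) {t : ℝ} (ht : 0 ≤ t) :
    ((-(C * (Real.exp (Λ * t) - 1)) : ℝ) : EReal) ≤ u x t := by
  by_contra! hlt
  rcases ht.eq_or_lt with rfl | ht
  · refine absurd hlt (not_lt.2 ?_)
    simpa using h0 x
  obtain ⟨r₀, hr₀⟩ : ∃ r : ℝ, u x t = (r : EReal) :=
    ⟨(u x t).toReal, (EReal.coe_toReal hlt.ne_top (hu.1 x t ht.le)).symm⟩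
  let w : ℝ → ℝ := fun s => -(C * (Real.exp (Λ * s) - 1))
  have hr₀w : r₀ < w t := by rw [hr₀] at hlt; exact_mod_cast hlt
  -- The time interval extends beyond `t` so that the touching point can be kept away from its upper
  -- end.
  let D : Set (M × ℝ) := univ ×ˢ Icc 0 (t + 1)
  have hD : IsCompact D := isCompact_univ.prod isCompact_Icc
  have huD : LowerSemicontinuousOn (fun q : M × ℝ => u q.1 q.2) D :=
    hu.2.mono (prod_mono_right fun s hs => hs.1)
  have hbot : ∀ p ∈ D, u p.1 p.2 ≠ ⊥ := fun p hp => hu.1 p.1 p.2 hp.2.1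
  obtain ⟨L, hL⟩ := huD.exists_real_le hD hbot
  set ε := w t - r₀ with hε
  have hε0 : 0 < ε := sub_pos.2 hr₀w
  -- Touching gives `N e^{μt} ≥ ε`, so at time `t + 1` the penalty is at least `ε e^μ > |L|`, which
  -- excludes contact there; `μ > Λ` gives strictness in the final inequality.
  let μ : ℝ := Λ + (|L| / ε + 1)
  have hμΛ : Λ < μ := lt_add_of_pos_right _ (by positivity)
  obtain ⟨⟨z, s⟩, hp, N, hN, hup, hle⟩ := huD.exists_touching hD hbot
    (ψ := fun q => w q.2) (g := fun q => Real.exp (μ * q.2)) (by fun_prop) (by fun_prop)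
    (fun _ _ => Real.exp_pos _) (p₀ := (x, t)) ⟨mem_univ _, ht.le, by simp⟩ hlt
  simp only at hup
  have hw0 : ∀ s, 0 ≤ s → w s ≤ 0 := by
    intro s hs
    have : 1 ≤ Real.exp (Λ * s) := Real.one_le_exp (by positivity)
    have : 0 ≤ C * (Real.exp (Λ * s) - 1) := mul_nonneg hC.le (by linarith)
    simpa [w] using this
  have hs0 : 0 < s := by
    refine lt_of_le_of_ne hp.2.1 fun h => ?_
    have h1 := h0 z
    rw [h, hup] at h1
    have h2 : 0 ≤ w s - N * Real.exp (μ * s) := by exact_mod_cast h1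
    have := hw0 s hp.2.1
    have : 0 < N * Real.exp (μ * s) := by positivity
    linarith
  have hsT : s < t + 1 := by
    refine lt_of_le_of_ne hp.2.2 fun h => ?_
    have h1 := hL _ hp
    rw [hup] at h1
    have h2 : L ≤ w s - N * Real.exp (μ * s) := by exact_mod_cast h1
    have h3 := hle (x, t) ⟨mem_univ _, ht.le, by simp⟩
    rw [hr₀] at h3
    have h4 : w t - N * Real.exp (μ * t) ≤ r₀ := by exact_mod_cast h3
    have h5 : Real.exp (μ * s) = Real.exp (μ * t) * Real.exp μ := by
      rw [← Real.exp_add, h]; congr 1; ring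
    have h6 : |L| / ε < Real.exp μ := by
      have : μ = Λ + (|L| / ε + 1) := rfl
      linarith [Real.add_one_le_exp μ]
    rw [div_lt_iff₀ hε0] at h6
    have h7 : Real.exp μ * ε ≤ Real.exp μ * (N * Real.exp (μ * t)) := by gcongr; linarith
    have h8 := hw0 s hp.2.1
    have h9 := neg_abs_le L
    have h10 : N * Real.exp (μ * s) = Real.exp μ * (N * Real.exp (μ * t)) := by rw [h5]; ring
    linarith
  set r := w s - N * Real.exp (μ * s) with hr
  have key := hsuper.zero_le_of_local hu (φ := fun q => w q.2 - N * Real.exp (μ * q.2)) hs0 hup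
    (W := univ ×ˢ Ioo 0 (t + 1)) (prod_mem_nhds univ_mem (Ioo_mem_nhds hs0 hsT))
    (by
      have hf : ContDiff ℝ 1 fun s : ℝ => w s - N * Real.exp (μ * s) := by fun_prop
      exact (hf.contMDiff.comp contMDiff_snd).contMDiffOn)
    (fun q hq => hle q ⟨mem_univ _, hq.2.1.le, hq.2.2.le⟩) rfl
  have hd : timeDerivative (fun q : M × ℝ => w q.2 - N * Real.exp (μ * q.2)) z s =
      -(C * (Real.exp (Λ * s) * Λ)) - N * (Real.exp (μ * s) * μ) := by
    have h1 : HasDerivAt (fun s : ℝ => Real.exp (Λ * s)) (Real.exp (Λ * s) * Λ) s := by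
      simpa using ((hasDerivAt_id s).const_mul Λ).exp
    have h2 : HasDerivAt (fun s : ℝ => Real.exp (μ * s)) (Real.exp (μ * s) * μ) s := by
      simpa using ((hasDerivAt_id s).const_mul μ).exp
    exact ((((h1.sub_const 1).const_mul C).neg).sub (h2.const_mul N)).deriv
  have hx : spaceDifferential n (fun q : M × ℝ => w q.2 - N * Real.exp (μ * q.2)) z s = 0 := by
    unfold spaceDifferential
    exact (hasMFDerivAt_const (I := 𝓡 n) (I' := 𝓘(ℝ, ℝ)) (w s - N * Real.exp (μ * s)) z).mfderiv
  rw [hd, hx] at key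
  have h1 := (abs_le.1 (hlip z 0 r 0)).2
  have h2 := hH0 z
  have h3 : |r - 0| = -w s + N * Real.exp (μ * s) := by
    have : 0 < N * Real.exp (μ * s) := by positivity
    rw [sub_zero, abs_of_nonpos (by linarith [hw0 s hs0.le])]
    ring
  rw [h3] at h1
  have h4 : -w s = C * (Real.exp (Λ * s) - 1) := by simp [w]
  rw [h4] at h1
  have h5 : Λ * (N * Real.exp (μ * s)) < μ * (N * Real.exp (μ * s)) := by gcongr
  linarith

end LowerBound

/-! ### Covectors in chart coordinates -/

section ChartCovector

variable {n : ℕ} {M : Type*} [TopologicalSpace M]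
    [ChartedSpace (EuclideanSpace ℝ (Fin n)) M] [IsManifold (𝓡 n) ∞ M]

/-- The covector at `z` with coordinates `q` in the chart centered at `c`. -/
noncomputable def chartCovector (c z : M) (q : EuclideanSpace ℝ (Fin n) →L[ℝ] ℝ) : CotangentSpace n z :=
  q ∘L (trivializationAt (EuclideanSpace ℝ (Fin n)) (TangentSpace (𝓡 n)) c).continuousLinearMapAt
    ℝ z

theorem chartCovector_add (c z : M) (q q' : EuclideanSpace ℝ (Fin n) →L[ℝ] ℝ) :
    chartCovector c z (q + q') = chartCovector c z q + chartCovector c z q' :=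
  ContinuousLinearMap.add_comp _ _ _

theorem chartCovector_smul (c z : M) (a : ℝ) (q : EuclideanSpace ℝ (Fin n) →L[ℝ] ℝ) :
    chartCovector c z (a • q) = a • chartCovector c z q :=
  ContinuousLinearMap.smul_comp _ _ _

theorem chartCovector_zero (c z : M) :
    chartCovector c z (0 : EuclideanSpace ℝ (Fin n) →L[ℝ] ℝ) = 0 :=
  ContinuousLinearMap.zero_comp _

/-- This map is the inverse of the trivialization at `c` of the bundle of continuous linear maps
from the tangent bundle to the trivial line bundle, hence continuous on the target of the latter. -/
theorem continuousOn_chartCovector (c : M) :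
    ContinuousOn (fun p : M × (EuclideanSpace ℝ (Fin n) →L[ℝ] ℝ) =>
      (⟨p.1, chartCovector c p.1 p.2⟩ : CotangentBundle n M))
      ((chartAt (EuclideanSpace ℝ (Fin n)) c).source ×ˢ univ) := by
  let e := trivializationAt (EuclideanSpace ℝ (Fin n) →L[ℝ] ℝ)
    (fun x : M => TangentSpace (𝓡 n) x →L[ℝ] Bundle.Trivial M ℝ x) c
  have h := e.toOpenPartialHomeomorph.continuousOn_symm
  have ht : e.toOpenPartialHomeomorph.target =
      (chartAt (EuclideanSpace ℝ (Fin n)) c).source ×ˢ univ := by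
    ext p
    simp [e]
  change ContinuousOn _ e.toOpenPartialHomeomorph.target at h
  rw [ht] at h
  refine h.congr fun p hp => ?_
  change (⟨p.1, chartCovector c p.1 p.2⟩ : CotangentBundle n M) =
    ⟨p.1, ((Bundle.Trivial.trivialization M ℝ).symmL ℝ p.1).comp (chartCovector c p.1 p.2)⟩
  rw [Bundle.Trivial.symmL_trivialization]
  rfl

end ChartCovector

/-! ### Linear growth of the Hamiltonian in the momentum -/

section Coercivity

variable {n : ℕ} {M : Type*} [MetricSpace M]
    [ChartedSpace (EuclideanSpace ℝ (Fin n)) M] [IsManifold (𝓡 n) ∞ M]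
    [Bundle.RiemannianBundle (fun x : M => TangentSpace (𝓡 n) x)]

theorem IsAdmissibleHamiltonian.exists_zero_le [CompactSpace M]
    {H : CotangentBundle n M → ℝ → ℝ} {Λ : ℝ} (hH : IsAdmissibleHamiltonian H Λ) :
    ∃ B : ℝ, 0 < B ∧ ∀ x : M, H ⟨x, 0⟩ 0 ≤ B := by
  have hc : Continuous fun x : M => H ⟨x, 0⟩ 0 := by
    refine hH.continuous.comp (f := fun x : M => ((⟨x, 0⟩, 0) : CotangentBundle n M × ℝ)) ?_
    refine Continuous.prodMk ?_ continuous_const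
    rw [continuous_iff_continuousAt]
    intro c
    have h := (continuousOn_chartCovector c).continuousAt
      (prod_mem_nhds (chart_source_mem_nhds (EuclideanSpace ℝ (Fin n)) c) univ_mem)
      (x := (c, 0))
    have h2 := ContinuousAt.comp (f := fun x : M => (x, (0 : EuclideanSpace ℝ (Fin n) →L[ℝ] ℝ)))
      (x := c) h (by fun_prop)
    refine h2.congr (Eventually.of_forall fun x => ?_)
    simp [chartCovector_zero]
  obtain ⟨B, hB⟩ := (isCompact_range hc).bddAbove
  exact ⟨max B 1, by positivity, fun x => (hB (mem_range_self x)).trans (le_max_left _ _)⟩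

variable
    [IsContMDiffRiemannianBundle (𝓡 n) ∞ (EuclideanSpace ℝ (Fin n))
      (fun x : M => TangentSpace (𝓡 n) x)]

theorem isContinuousRiemannianBundle_tangentSpace :
    IsContinuousRiemannianBundle (EuclideanSpace ℝ (Fin n))
      (fun x : M => TangentSpace (𝓡 n) x) := by
  obtain ⟨g, hg, h⟩ := IsContMDiffRiemannianBundle.exists_contMDiff (IB := 𝓡 n) (n := ∞)
    (F := EuclideanSpace ℝ (Fin n)) (E := fun x : M => TangentSpace (𝓡 n) x)
  exact ⟨g, hg.continuous, h⟩

/-- The coordinates `q` are recovered by composing the covector with the inverse trivialization,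
whose operator norm is locally bounded. This transfers coercivity from the dual Riemannian norm to
coordinates. -/
theorem exists_norm_le_norm_chartCovector (c : M) :
    ∃ K : ℝ, 0 < K ∧ ∀ᶠ z in 𝓝 c, ∀ q : EuclideanSpace ℝ (Fin n) →L[ℝ] ℝ,
      ‖q‖ ≤ K * ‖chartCovector c z q‖ := by
  have := isContinuousRiemannianBundle_tangentSpace (n := n) (M := M)
  obtain ⟨K, hK, h⟩ := eventually_norm_symmL_trivializationAt_lt (EuclideanSpace ℝ (Fin n))
    (fun x : M => TangentSpace (𝓡 n) x) c
  refine ⟨K, hK, ?_⟩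
  filter_upwards [h, chart_source_mem_nhds (EuclideanSpace ℝ (Fin n)) c] with z hz hz' q
  have hq : q = (chartCovector c z q).comp ((trivializationAt (EuclideanSpace ℝ (Fin n))
      (fun x : M => TangentSpace (𝓡 n) x) c).symmL ℝ z) := by
    ext v
    change q v = q _
    congr 1
    exact (Bundle.Trivialization.continuousLinearMapAt_symmL (R := ℝ) _ (by simpa using hz') v).symm
  calc ‖q‖ = ‖(chartCovector c z q).comp ((trivializationAt (EuclideanSpace ℝ (Fin n))
      (fun x : M => TangentSpace (𝓡 n) x) c).symmL ℝ z)‖ := congrArg norm hq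
    _ ≤ ‖chartCovector c z q‖ * K :=
      (ContinuousLinearMap.opNorm_comp_le _ _).trans (by gcongr)
    _ = K * ‖chartCovector c z q‖ := mul_comm _ _

/-- In a chart, `H` grows at least linearly in the momentum. -/
theorem IsAdmissibleHamiltonian.exists_linear_le [CompactSpace M]
    {H : CotangentBundle n M → ℝ → ℝ} {Λ : ℝ} (hH : IsAdmissibleHamiltonian H Λ) (c : M) :
    ∃ δ B : ℝ, 0 < δ ∧ ∀ᶠ z in 𝓝 c, ∀ (q : EuclideanSpace ℝ (Fin n) →L[ℝ] ℝ) (v : ℝ),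
      δ * ‖q‖ - B - Λ * |v| ≤ H ⟨z, chartCovector c z q⟩ v := by
  obtain ⟨K₁, hK₁, hN₁⟩ := exists_norm_le_norm_chartCovector (n := n) c
  obtain ⟨N, hN, hNs, hNc⟩ := LocallyCompactSpace.local_compact_nhds c _
    (inter_mem hN₁ (chart_source_mem_nhds (EuclideanSpace ℝ (Fin n)) c))
  let G : M × (EuclideanSpace ℝ (Fin n) →L[ℝ] ℝ) → ℝ := fun p => H ⟨p.1, chartCovector c p.1 p.2⟩ 0
  have hG : ContinuousOn G (N ×ˢ univ) := by
    have h1 : ContinuousOn (fun p : M × (EuclideanSpace ℝ (Fin n) →L[ℝ] ℝ) =>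
        (((⟨p.1, chartCovector c p.1 p.2⟩ : CotangentBundle n M), (0 : ℝ)))) (N ×ˢ univ) :=
      ((continuousOn_chartCovector c).mono
        (prod_mono_left fun z hz => (hNs hz).2)).prodMk continuousOn_const
    exact hH.continuous.comp_continuousOn h1
  obtain ⟨B₀, hB₀⟩ := ((hNc.prod (isCompact_singleton (x := 0))).image_of_continuousOn
    (hG.mono (prod_mono_right (subset_univ _)))).isBounded.exists_norm_le
  have hB₀' : ∀ z ∈ N, |G (z, 0)| ≤ B₀ := fun z hz => hB₀ _ ⟨(z, 0), ⟨hz, rfl⟩, rfl⟩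
  have hB₀0 : 0 ≤ B₀ := (abs_nonneg _).trans (hB₀' c (mem_of_mem_nhds hN))
  -- On the coordinate sphere of radius `K₁ * K`, `H` exceeds its value at zero momentum by at least
  -- `1`. By convexity it then grows along rays with slope at least `(K₁ * K)⁻¹` outside the ball;
  -- inside, compactness bounds it.
  obtain ⟨K, hK, hKH⟩ := hH.coercive (B₀ + 1) (by linarith)
  have hKK : 0 < K₁ * K := by positivity
  obtain ⟨B₁, hB₁⟩ := ((hNc.prod (isCompact_closedBall 0 (K₁ * K))).image_of_continuousOn
    (hG.mono (prod_mono_right (subset_univ _)))).isBounded.exists_norm_le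
  have hB₁' : ∀ z ∈ N, ∀ q, ‖q‖ ≤ K₁ * K → |G (z, q)| ≤ B₁ :=
    fun z hz q hq => hB₁ _ ⟨(z, q), ⟨hz, by simpa using hq⟩, rfl⟩
  have hB₁0 : 0 ≤ B₁ := (abs_nonneg _).trans (hB₁' c (mem_of_mem_nhds hN) 0 (by simpa using hKK.le))
  refine ⟨(K₁ * K)⁻¹, B₁ + 1, by positivity, ?_⟩
  filter_upwards [hN] with z hz q v
  have key : (K₁ * K)⁻¹ * ‖q‖ - (B₁ + 1) ≤ G (z, q) := by
    rcases le_or_gt ‖q‖ (K₁ * K) with hq | hq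
    · have h1 := (abs_le.1 (hB₁' z hz q hq)).1
      have h2 : (K₁ * K)⁻¹ * ‖q‖ ≤ 1 := by
        rw [inv_mul_le_iff₀ hKK]; linarith
      linarith
    · have hq0 : 0 < ‖q‖ := hKK.trans hq
      set s := K₁ * K / ‖q‖ with hs
      have hs0 : 0 < s := by positivity
      have hs1 : s ≤ 1 := (div_le_one hq0).2 hq.le
      have hn : ‖s • q‖ = K₁ * K := by
        rw [norm_smul, Real.norm_of_nonneg hs0.le, hs, div_mul_cancel₀ _ hq0.ne']
      have h1 : B₀ + 1 < G (z, s • q) := by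
        refine hKH z _ 0 (by simpa using by linarith) ?_
        have h2 := (hNs hz).1 (s • q)
        rw [hn] at h2
        exact le_of_mul_le_mul_left h2 hK₁
      have h2 : G (z, s • q) ≤ (1 - s) * G (z, 0) + s * G (z, q) := by
        have := (hH.convex z 0).2 (mem_univ (chartCovector c z 0)) (mem_univ (chartCovector c z q))
          (sub_nonneg.2 hs1) hs0.le (by ring)
        rw [← chartCovector_smul, ← chartCovector_smul, ← chartCovector_add, smul_zero,
          zero_add] at this
        exact this
      have h3 := (abs_le.1 (hB₀' z hz)).2
      have h4 : (1 - s) * G (z, 0) ≤ (1 - s) * B₀ :=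
        mul_le_mul_of_nonneg_left h3 (sub_nonneg.2 hs1)
      have h5 : s * ((K₁ * K)⁻¹ * ‖q‖) = 1 := by
        rw [hs]; field_simp
      have h6 : s * ((K₁ * K)⁻¹ * ‖q‖) < s * G (z, q) := by
        rw [h5]; nlinarith
      have := lt_of_mul_lt_mul_left h6 hs0.le
      linarith
  have h := (abs_le.1 (hH.lipschitz z (chartCovector c z q) v 0)).1
  rw [sub_zero] at h
  have : G (z, q) = H ⟨z, chartCovector c z q⟩ 0 := rfl
  linarith

end Coercivity

/-! ### Propagation of upper bounds along a segment in a chart -/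

section Propagation

variable {n : ℕ} {M : Type*} [MetricSpace M]
    [ChartedSpace (EuclideanSpace ℝ (Fin n)) M] [IsManifold (𝓡 n) ∞ M]

/-- Chain rule: the differential at `z` of the chart centered at `c` is the tangent trivialization
at `c`, which defines `chartCovector`. -/
theorem spaceDifferential_comp_extChartAt (c : M) {φ : M × ℝ → ℝ}
    {F : EuclideanSpace ℝ (Fin n) → ℝ} {q : EuclideanSpace ℝ (Fin n) →L[ℝ] ℝ} {z : M} {s : ℝ}
    (hz : z ∈ (chartAt (EuclideanSpace ℝ (Fin n)) c).source)
    (hφ : ∀ z, φ (z, s) = F (extChartAt (𝓡 n) c z))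
    (hF : HasFDerivAt F q (extChartAt (𝓡 n) c z)) :
    spaceDifferential n φ z s = chartCovector c z q := by
  have h1 : (fun z : M => φ (z, s)) = F ∘ extChartAt (𝓡 n) c := funext hφ
  have h2 := hF.hasMFDerivAt.comp z
    (mdifferentiableAt_extChartAt (I := 𝓡 n) hz).hasMFDerivAt
  rw [← h1] at h2
  unfold spaceDifferential chartCovector
  rw [h2.mfderiv, TangentBundle.continuousLinearMapAt_trivializationAt hz]
  rfl

theorem hasFDerivAt_sub_mul_norm_sub_sq (α k β : ℝ) (y ζ : EuclideanSpace ℝ (Fin n)) :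
    HasFDerivAt (fun ζ : EuclideanSpace ℝ (Fin n) => α - k * ‖ζ - y‖ ^ 2 - β)
      (-((2 * k) • innerSL ℝ (ζ - y))) ζ := by
  have h := ((((hasFDerivAt_id ζ).sub_const y).norm_sq.const_mul k).const_sub α).sub_const β
  refine h.congr_fderiv ?_
  ext w
  simp
  ring

theorem norm_neg_two_mul_smul_innerSL {k : ℝ} (hk : 0 ≤ k) (w : EuclideanSpace ℝ (Fin n)) :
    ‖-((2 * k) • innerSL ℝ w)‖ = 2 * k * ‖w‖ := by
  rw [norm_neg, norm_smul, innerSL_apply_norm, Real.norm_of_nonneg (by positivity)]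

set_option maxHeartbeats 1600000 in
/-- In a chart ball where `H` grows linearly in the momentum, upper bounds for a subsolution
propagate along segments of small speed. -/
theorem IsBJSubsolution.le_along_segment [CompactSpace M]
    {H : CotangentBundle n M → ℝ → ℝ} {u : M → ℝ → EReal}
    (hsub : IsBJSubsolution H u) (hu : IsLSCExtendedReal u) {Λ δ B C ρ : ℝ} (hΛ : 0 < Λ)
    (hC : 0 < C) (hBC : B < Λ * C) (hρ : 0 < ρ) (hρδ : Λ * (3 * ρ) ≤ δ) {c : M}
    (htarget : Metric.closedBall (extChartAt (𝓡 n) c c) (2 * ρ) ⊆ (extChartAt (𝓡 n) c).target)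
    (hH : ∀ z ∈ (extChartAt (𝓡 n) c).source,
      extChartAt (𝓡 n) c z ∈ Metric.closedBall (extChartAt (𝓡 n) c c) (2 * ρ) →
      ∀ (q : EuclideanSpace ℝ (Fin n) →L[ℝ] ℝ) (v : ℝ),
        δ * ‖q‖ - B - Λ * |v| ≤ H ⟨z, chartCovector c z q⟩ v)
    {x x' : M} (hx : x ∈ (extChartAt (𝓡 n) c).source) (hx' : x' ∈ (extChartAt (𝓡 n) c).source)
    (hxρ : extChartAt (𝓡 n) c x ∈ Metric.ball (extChartAt (𝓡 n) c c) ρ)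
    (hxρ' : extChartAt (𝓡 n) c x' ∈ Metric.ball (extChartAt (𝓡 n) c c) ρ)
    {t₁ t₂ : ℝ} (ht₁ : 0 < t₁) (ht : t₁ < t₂)
    (hspeed : ‖extChartAt (𝓡 n) c x' - extChartAt (𝓡 n) c x‖ ≤ δ / 2 * (t₂ - t₁))
    {A : ℝ} (hA : 0 ≤ A) (huA : u x t₁ ≤ (A : EReal)) :
    u x' t₂ ≤ (((A + C) * Real.exp (Λ * (t₂ - t₁)) - C : ℝ) : EReal) := by
  by_contra! hlt
  set f := extChartAt (𝓡 n) c with hf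
  -- An intermediate value leaves room on both sides: `ε > 0` below it, and `u > b` near `x'` at
  -- time `t₂` by lower semicontinuity.
  obtain ⟨b, hb1, hb2⟩ := EReal.lt_iff_exists_real_btwn.1 hlt
  replace hb1 : (A + C) * Real.exp (Λ * (t₂ - t₁)) - C < b := by exact_mod_cast hb1
  obtain ⟨ε, hε, hbε⟩ : ∃ ε : ℝ, 0 < ε ∧ (A + ε + C) * Real.exp (Λ * (t₂ - t₁)) - C = b := by
    refine ⟨(b + C) / Real.exp (Λ * (t₂ - t₁)) - (A + C), ?_, ?_⟩
    · rw [sub_pos, lt_div_iff₀ (Real.exp_pos _)]; linarith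
    · field_simp; ring
  -- Solution of `a' = Λ(a + C)` with `a(t₁) = A + ε` and `a(t₂) = b`.
  let a : ℝ → ℝ := fun s => (A + ε + C) * Real.exp (Λ * (s - t₁)) - C
  have ha_mono : Monotone a := by
    intro s s' h
    have h1 : Λ * (s - t₁) ≤ Λ * (s' - t₁) := by gcongr
    have h2 : (A + ε + C) * Real.exp (Λ * (s - t₁)) ≤ (A + ε + C) * Real.exp (Λ * (s' - t₁)) := by
      gcongr
    exact sub_le_sub_right h2 C
  have ha₂ : a t₂ = b := hbε
  have ha₁ : a t₁ = A + ε := by simp [a]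
  have ha_cont : Continuous a := by fun_prop
  set v : EuclideanSpace ℝ (Fin n) := (t₂ - t₁)⁻¹ • (f x' - f x) with hv
  have hτ : 0 < t₂ - t₁ := sub_pos.2 ht
  have hvδ : ‖v‖ ≤ δ / 2 := by
    rw [hv, norm_smul, Real.norm_of_nonneg (by positivity), inv_mul_le_iff₀ hτ]
    linarith
  let γ : ℝ → EuclideanSpace ℝ (Fin n) := fun s => f x + (s - t₁) • v
  have hγ₁ : γ t₁ = f x := by simp [γ]
  have hγ₂ : γ t₂ = f x' := by simp [γ, hv, smul_smul, hτ.ne']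
  have hγ_cont : Continuous γ := by fun_prop
  -- The bound by `A` is known only at the single point `(x, t₁)`, so the time window opens slightly
  -- before `t₁`; the penalty `N e^{μ(t₁ - s)}` will exclude contact at `t₀`.
  obtain ⟨t₀, ht₀1, ht₀, hat₀, hγt₀⟩ : ∃ t₀ : ℝ, t₀ < t₁ ∧ 0 < t₀ ∧ 0 ≤ a t₀ ∧
      γ t₀ ∈ Metric.ball (f c) ρ := by
    have h1 : ∀ᶠ s in 𝓝 t₁, 0 < s := lt_mem_nhds ht₁
    have h2 : ∀ᶠ s in 𝓝 t₁, 0 < a s :=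
      ha_cont.continuousAt.eventually (lt_mem_nhds (by rw [ha₁]; positivity))
    have h3 : ∀ᶠ s in 𝓝 t₁, γ s ∈ Metric.ball (f c) ρ :=
      hγ_cont.continuousAt.eventually (Metric.isOpen_ball.mem_nhds (by rwa [hγ₁]))
    have h4 : ∀ᶠ s in 𝓝[<] t₁, s < t₁ := self_mem_nhdsWithin
    obtain ⟨s, hs, hs1, hs2, hs3⟩ :=
      (h4.and (nhdsWithin_le_nhds (h1.and (h2.and h3)))).exists
    exact ⟨s, hs, hs1, hs2.le, hs3⟩
  have ha_nonneg : ∀ s, t₀ ≤ s → 0 ≤ a s := fun s hs => hat₀.trans (ha_mono hs)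
  have hγ_ball : ∀ s ∈ Icc t₀ t₂, γ s ∈ Metric.ball (f c) ρ := by
    intro s hs
    have h02 : 0 < t₂ - t₀ := by linarith
    have h := (convex_ball (f c) ρ) hγt₀ (hγ₂ ▸ hxρ')
      (a := (t₂ - s) / (t₂ - t₀)) (b := (s - t₀) / (t₂ - t₀))
      (div_nonneg (by linarith [hs.2]) h02.le) (div_nonneg (by linarith [hs.1]) h02.le)
      (by field_simp; ring)
    convert h using 1
    simp only [γ, smul_add, smul_smul]
    have e1 : (t₂ - s) / (t₂ - t₀) + (s - t₀) / (t₂ - t₀) = 1 := by field_simp; ring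
    have e2 : (t₂ - s) / (t₂ - t₀) * (t₀ - t₁) + (s - t₀) / (t₂ - t₀) * (t₂ - t₁) = s - t₁ := by
      field_simp; ring
    rw [add_add_add_comm, ← add_smul, ← add_smul, e1, e2, one_smul]
  let Q : Set M := f.symm '' Metric.closedBall (f c) (2 * ρ)
  have hQc : IsCompact Q := (isCompact_closedBall _ _).image_of_continuousOn
    ((continuousOn_extChartAt_symm c).mono htarget)
  have hQ : ∀ z ∈ Q, z ∈ f.source ∧ f z ∈ Metric.closedBall (f c) (2 * ρ) := by
    rintro _ ⟨ζ, hζ, rfl⟩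
    exact ⟨f.map_target (htarget hζ), by rwa [f.right_inv (htarget hζ)]⟩
  have hQmem : ∀ z ∈ f.source, f z ∈ Metric.closedBall (f c) (2 * ρ) → z ∈ Q :=
    fun z hz hz' => ⟨f z, hz', f.left_inv hz⟩
  have hball : Metric.ball (f c) ρ ⊆ Metric.closedBall (f c) (2 * ρ) :=
    (Metric.ball_subset_ball (by linarith)).trans Metric.ball_subset_closedBall
  let D : Set (M × ℝ) := Q ×ˢ Icc t₀ t₂
  have hD : IsCompact D := hQc.prod isCompact_Icc
  have huD : LowerSemicontinuousOn (fun q : M × ℝ => u q.1 q.2) D :=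
    hu.2.mono (prod_mono (subset_univ _) fun s hs => ht₀.le.trans hs.1)
  have hbot : ∀ p ∈ D, u p.1 p.2 ≠ ⊥ := fun p hp => hu.1 p.1 p.2 (ht₀.le.trans hp.2.1)
  obtain ⟨L, hL⟩ := huD.exists_real_le hD hbot
  obtain ⟨η, hη, hηu⟩ : ∃ η : ℝ, 0 < η ∧ ∀ z ∈ Q, ‖f z - f x'‖ < η → (b : EReal) < u z t₂ := by
    have h1 := hu.2 (x', t₂) ⟨mem_univ _, (ht₁.trans ht).le⟩ b hb2
    rw [eventually_nhdsWithin_iff] at h1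
    have h2 : ∀ᶠ z in 𝓝 x', (b : EReal) < u z t₂ := by
      have := (Continuous.prodMk_left (X := M) t₂).continuousAt.eventually h1
      filter_upwards [this] with z hz using hz ⟨mem_univ _, (ht₁.trans ht).le⟩
    have h3 : ∀ᶠ ζ in 𝓝 (f x'), (b : EReal) < u (f.symm ζ) t₂ := by
      have h4 := (continuousAt_extChartAt_symm'' (I := 𝓡 n) (f.map_source hx'))
      rw [ContinuousAt, ← hf, f.left_inv hx'] at h4
      exact h4.eventually h2
    obtain ⟨η, hη, h5⟩ := Metric.eventually_nhds_iff.1 h3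
    refine ⟨η, hη, fun z hz hz' => ?_⟩
    have := h5 (y := f z) (by rwa [dist_eq_norm])
    rwa [f.left_inv (hQ z hz).1] at this
  -- The paraboloid must push the test function below the lower bound `L` of `u` at distance `ρ`
  -- from `γ`, hence on the lateral boundary, and at time `t₂` at distance `η` from the endpoint.
  -- Closer to the endpoint, `u > b` already excludes contact.
  obtain ⟨k, hk, hkη, hkρ⟩ : ∃ k : ℝ, 0 < k ∧ |L| + b ≤ k * η ^ 2 ∧ |L| + b ≤ k * ρ ^ 2 := by
    have hb0 : 0 ≤ b := ha₂ ▸ ha_nonneg t₂ (by linarith)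
    have hm : 0 < min η ρ := lt_min hη hρ
    have h1 : |L| + b ≤ (|L| + b + 1) / (min η ρ) ^ 2 * (min η ρ) ^ 2 := by
      rw [div_mul_cancel₀ _ (by positivity)]; linarith
    refine ⟨(|L| + b + 1) / (min η ρ) ^ 2, by positivity, h1.trans ?_, h1.trans ?_⟩
    · gcongr; exact min_le_left _ _
    · gcongr; exact min_le_right _ _
  have hτ₀ : 0 < t₁ - t₀ := sub_pos.2 ht₀1
  have hb0 : 0 ≤ b := ha₂ ▸ ha_nonneg t₂ (by linarith)
  -- Since `N ≥ ε`, this size of `μ` makes the penalty at `t₀` exceed `|L| + b`.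
  let μ : ℝ := Λ + 1 + (|L| + b) / (ε * (t₁ - t₀))
  have hμΛ : Λ < μ := by
    have : 0 ≤ (|L| + b) / (ε * (t₁ - t₀)) := by positivity
    have : μ = Λ + 1 + (|L| + b) / (ε * (t₁ - t₀)) := rfl
    linarith
  have hμε : |L| + b < ε * Real.exp (μ * (t₁ - t₀)) := by
    have h1 : (|L| + b) / (ε * (t₁ - t₀)) ≤ μ := by
      have : μ = Λ + 1 + (|L| + b) / (ε * (t₁ - t₀)) := rfl
      linarith
    rw [div_le_iff₀ (by positivity)] at h1
    have h2 := Real.add_one_le_exp (μ * (t₁ - t₀))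
    nlinarith
  have hfD : ContinuousOn (fun q : M × ℝ => f q.1) D :=
    (continuousOn_extChartAt c).comp continuousOn_fst fun q hq => (hQ q.1 hq.1).1
  have hψD : ContinuousOn (fun q : M × ℝ => a q.2 - k * ‖f q.1 - γ q.2‖ ^ 2) D :=
    (ha_cont.comp_continuousOn continuousOn_snd).sub (continuousOn_const.mul
      ((hfD.sub (hγ_cont.comp_continuousOn continuousOn_snd)).norm.pow 2))
  have hx₁D : (x, t₁) ∈ D := ⟨hQmem x hx (hball hxρ), ht₀1.le, ht.le⟩
  obtain ⟨⟨z, s⟩, hp, N, hN, hup, hle⟩ := huD.exists_touching hD hbot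
    (ψ := fun q => a q.2 - k * ‖f q.1 - γ q.2‖ ^ 2) (g := fun q => Real.exp (μ * (t₁ - q.2)))
    hψD (by fun_prop) (fun _ _ => Real.exp_pos _) hx₁D
    (by
      simp only [hγ₁, sub_self, norm_zero, ha₁]
      refine huA.trans_lt ?_
      exact_mod_cast (by linarith : A < A + ε - k * 0 ^ 2))
  simp only at hup
  have hNε : ε ≤ N := by
    have h := (hle _ hx₁D).trans huA
    simp only [hγ₁, sub_self, norm_zero, ha₁] at h
    have h' : A + ε - k * 0 ^ 2 - N * Real.exp (μ * 0) ≤ A := by exact_mod_cast h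
    simp at h'
    linarith
  set r := a s - k * ‖f z - γ s‖ ^ 2 - N * Real.exp (μ * (t₁ - s)) with hr
  have hLr : L ≤ r := by
    have h := hL _ hp
    rw [hup] at h
    exact_mod_cast h
  have has : a s ≤ b := ha₂ ▸ ha_mono hp.2.2
  have hNg : 0 < N * Real.exp (μ * (t₁ - s)) := by positivity
  have hL' := neg_abs_le L
  have hkd : 0 ≤ k * ‖f z - γ s‖ ^ 2 := by positivity
  have hst₀ : t₀ < s := by
    refine lt_of_le_of_ne hp.2.1 fun h => ?_
    rw [← h] at hr has hkd
    have h1 : ε * Real.exp (μ * (t₁ - t₀)) ≤ N * Real.exp (μ * (t₁ - t₀)) := by gcongr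
    linarith
  have hst₂ : s < t₂ := by
    refine lt_of_le_of_ne hp.2.2 fun h => ?_
    rcases lt_or_ge ‖f z - f x'‖ η with h1 | h1
    · have h2 := hηu z hp.1 h1
      rw [← h, hup] at h2
      have h3 : b < r := by exact_mod_cast h2
      linarith
    · have h2 : k * η ^ 2 ≤ k * ‖f z - γ s‖ ^ 2 := by
        rw [h, hγ₂]; gcongr
      linarith
  have hγs : ‖γ s - f c‖ < ρ := by
    simpa [dist_eq_norm] using hγ_ball s hp.2
  have hzs : ‖f z - f c‖ ≤ 2 * ρ := by
    simpa [dist_eq_norm] using (hQ z hp.1).2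
  have htri : ‖f z - f c‖ ≤ ‖f z - γ s‖ + ‖γ s - f c‖ := norm_sub_le_norm_sub_add_norm_sub _ _ _
  have hzρ : ‖f z - f c‖ < 2 * ρ := by
    refine lt_of_le_of_ne hzs fun h => ?_
    have h2 : k * ρ ^ 2 ≤ k * ‖f z - γ s‖ ^ 2 := by
      gcongr; linarith
    linarith
  have hzc : z ∈ (chartAt (EuclideanSpace ℝ (Fin n)) c).source := by
    simpa [hf] using (hQ z hp.1).1
  let V : Set M := f.source ∩ f ⁻¹' Metric.ball (f c) (2 * ρ)
  have hV : V ∈ 𝓝 z := by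
    refine inter_mem ((isOpen_extChartAt_source c).mem_nhds (hQ z hp.1).1) ?_
    refine (continuousAt_extChartAt' (hQ z hp.1).1).preimage_mem_nhds ?_
    exact Metric.isOpen_ball.mem_nhds (mem_ball_iff_norm.2 hzρ)
  have key := hsub.le_zero_of_local hu (φ := fun q => a q.2 - k * ‖f q.1 - γ q.2‖ ^ 2 -
      N * Real.exp (μ * (t₁ - q.2))) (ht₀.trans hst₀) hup
    (W := V ×ˢ Ioo t₀ t₂) (prod_mem_nhds hV (Ioo_mem_nhds hst₀ hst₂))
    (by
      have h1 : ContDiff ℝ 1 fun q : EuclideanSpace ℝ (Fin n) × ℝ =>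
          a q.2 - k * ‖q.1 - γ q.2‖ ^ 2 - N * Real.exp (μ * (t₁ - q.2)) := by
        have : ContDiff ℝ 1 fun q : EuclideanSpace ℝ (Fin n) × ℝ => ‖q.1 - γ q.2‖ ^ 2 :=
          ContDiff.norm_sq ℝ (by fun_prop)
        fun_prop
      have h2 : ContMDiffOn ((𝓡 n).prod 𝓘(ℝ, ℝ)) 𝓘(ℝ, EuclideanSpace ℝ (Fin n)) 1
          (fun q : M × ℝ => f q.1) (V ×ˢ Ioo t₀ t₂) :=
        ((contMDiffOn_extChartAt (I := 𝓡 n) (n := ∞) (x := c)).of_le (by simp)).comp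
          contMDiffOn_fst (fun q hq => by simpa [hf] using hq.1.1)
      have h3 : ContMDiffOn ((𝓡 n).prod 𝓘(ℝ, ℝ)) 𝓘(ℝ, EuclideanSpace ℝ (Fin n) × ℝ) 1
          (fun q : M × ℝ => (f q.1, q.2)) (V ×ˢ Ioo t₀ t₂) :=
        h2.prodMk_space contMDiffOn_snd
      exact h1.contMDiff.comp_contMDiffOn h3)
    (fun q hq => hle q ⟨hQmem _ hq.1.1 (Metric.ball_subset_closedBall hq.1.2),
      hq.2.1.le, hq.2.2.le⟩) rfl
  rw [spaceDifferential_comp_extChartAt (φ := fun q => a q.2 - k * ‖f q.1 - γ q.2‖ ^ 2 -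
      N * Real.exp (μ * (t₁ - q.2))) c hzc (fun _ => rfl)
    (hasFDerivAt_sub_mul_norm_sub_sq (a s) k (N * Real.exp (μ * (t₁ - s))) (γ s) _)] at key
  have hd : timeDerivative (fun q : M × ℝ => a q.2 - k * ‖f q.1 - γ q.2‖ ^ 2 -
      N * Real.exp (μ * (t₁ - q.2))) z s =
      Λ * (a s + C) + 2 * k * inner ℝ (f z - γ s) v + N * (μ * Real.exp (μ * (t₁ - s))) := by
    have h1 : HasDerivAt a (Λ * (a s + C)) s := by
      have := (((((hasDerivAt_id s).sub_const t₁).const_mul Λ).exp).const_mul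
        (A + ε + C)).sub_const C
      refine this.congr_deriv ?_
      simp [a]; ring
    have h2 : HasDerivAt (fun s => ‖f z - γ s‖ ^ 2) (-(2 * inner ℝ (f z - γ s) v)) s := by
      have h3 : HasDerivAt γ v s := by
        refine ((((hasDerivAt_id s).sub_const t₁).smul_const v).const_add (f x)).congr_deriv ?_
        simp
      refine (h3.const_sub (f z)).norm_sq.congr_deriv ?_
      simp
    have h4 : HasDerivAt (fun s => Real.exp (μ * (t₁ - s))) (-(μ * Real.exp (μ * (t₁ - s)))) s := by
      refine ((((hasDerivAt_id s).const_sub t₁).const_mul μ).exp).congr_deriv ?_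
      simp; ring
    refine (((h1.sub (h2.const_mul k)).sub (h4.const_mul N)).deriv).trans ?_
    ring
  rw [hd] at key
  have hHz := hH z (hQ z hp.1).1 (hQ z hp.1).2 (-((2 * k) • innerSL ℝ (f z - γ s))) r
  rw [norm_neg_two_mul_smul_innerSL hk.le] at hHz
  set d := ‖f z - γ s‖ with hd_def
  have hd0 : 0 ≤ d := norm_nonneg _
  have hd3 : d ≤ 3 * ρ := by
    have : ‖f z - γ s‖ ≤ ‖f z - f c‖ + ‖f c - γ s‖ := norm_sub_le_norm_sub_add_norm_sub _ _ _
    rw [norm_sub_rev (f c)] at this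
    linarith
  have hin : -(d * (δ / 2)) ≤ inner ℝ (f z - γ s) v := by
    have h1 := (abs_le.1 (abs_real_inner_le_norm (f z - γ s) v)).1
    have h2 : ‖f z - γ s‖ * ‖v‖ ≤ d * (δ / 2) := by gcongr
    linarith
  have hrabs : |r| ≤ a s + k * d ^ 2 + N * Real.exp (μ * (t₁ - s)) := by
    have := ha_nonneg s hst₀.le
    rw [abs_le]
    constructor <;> linarith
  -- The Hamiltonian contributes `2kδd`; the motion of the center costs at most `kδd`, and the `kd²`
  -- part of `Λ|r|` costs `Λkd² ≤ kδd`. What remains is `ΛC - B > 0` and `(μ - Λ)N e^{μ(t₁ - s)} >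
  -- 0`, against the subsolution inequality.
  have e1 : Λ * |r| ≤ Λ * (a s + k * d ^ 2 + N * Real.exp (μ * (t₁ - s))) := by gcongr
  have e2 : 2 * k * (-(d * (δ / 2))) ≤ 2 * k * inner ℝ (f z - γ s) v := by gcongr
  have e3 : Λ * (N * Real.exp (μ * (t₁ - s))) < μ * (N * Real.exp (μ * (t₁ - s))) := by gcongr
  have e4 : k * d * (Λ * d) ≤ k * d * δ := by
    gcongr
    exact (mul_le_mul_of_nonneg_left hd3 hΛ.le).trans hρδ
  linarith

end Propagation

/-! ### Riemannian distance and lengths of paths -/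

section PathLength

variable {n : ℕ} {M : Type*} [MetricSpace M]
    [ChartedSpace (EuclideanSpace ℝ (Fin n)) M]
    [Bundle.RiemannianBundle (fun x : M => TangentSpace (𝓡 n) x)]
    [IsRiemannianManifold (𝓡 n) M]

open scoped ENNReal

theorem edist_le_pathELength {γ : ℝ → M} {a b : ℝ} (hab : a ≤ b)
    (hγ : ContMDiffOn 𝓘(ℝ, ℝ) (𝓡 n) 1 γ (Icc a b)) :
    edist (γ a) (γ b) ≤ pathELength (𝓡 n) γ a b := by
  rw [IsRiemannianManifold.out (I := 𝓡 n) (γ a) (γ b)]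
  exact riemannianEDist_le_pathELength hγ rfl rfl hab

theorem exists_path_pathELength_lt {x y : M} {R : ℝ≥0∞} (h : edist x y < R) :
    ∃ γ : ℝ → M, γ 0 = x ∧ γ 1 = y ∧ ContMDiffOn 𝓘(ℝ, ℝ) (𝓡 n) 1 γ (Icc 0 1) ∧
      pathELength (𝓡 n) γ 0 1 < R := by
  rw [IsRiemannianManifold.out (I := 𝓡 n) x y] at h
  exact exists_lt_of_riemannianEDist_lt h

end PathLength

/-! ### Local Lipschitz bounds for charts -/

section ChartDistance

variable {n : ℕ} {M : Type*} [MetricSpace M]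
    [ChartedSpace (EuclideanSpace ℝ (Fin n)) M] [IsManifold (𝓡 n) ∞ M]
    [Bundle.RiemannianBundle (fun x : M => TangentSpace (𝓡 n) x)]

open scoped NNReal ENNReal

/-- A path along which the derivative of the chart is bounded by `C` has an image in the chart
whose endpoints are at distance at most `C` times the length of the path. -/
theorem enorm_extChartAt_sub_le_pathELength {c : M} {C : ℝ≥0} {γ : ℝ → M}
    (hγ : ContMDiffOn 𝓘(ℝ, ℝ) (𝓡 n) 1 γ (Icc 0 1))
    (hsource : ∀ s ∈ Icc (0 : ℝ) 1, γ s ∈ (chartAt (EuclideanSpace ℝ (Fin n)) c).source)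
    (hC : ∀ s ∈ Icc (0 : ℝ) 1, ‖(trivializationAt (EuclideanSpace ℝ (Fin n))
      (fun x : M => TangentSpace (𝓡 n) x) c).continuousLinearMapAt ℝ (γ s)‖ₑ ≤ C) :
    ‖extChartAt (𝓡 n) c (γ 1) - extChartAt (𝓡 n) c (γ 0)‖ₑ ≤ C * pathELength (𝓡 n) γ 0 1 := by
  have : IsManifold (𝓡 n) 1 M := IsManifold.of_le (n := ∞) (by simp)
  let e : ℝ → EuclideanSpace ℝ (Fin n) := extChartAt (𝓡 n) c ∘ γ
  have he : ContMDiffOn 𝓘(ℝ, ℝ) 𝓘(ℝ, EuclideanSpace ℝ (Fin n)) 1 e (Icc 0 1) :=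
    (contMDiffOn_extChartAt (I := 𝓡 n) (n := 1) (x := c)).comp hγ hsource
  calc ‖e 1 - e 0‖ₑ
    _ ≤ ∫⁻ t in Icc (0 : ℝ) 1, ‖derivWithin e (Icc 0 1) t‖ₑ :=
      enorm_sub_le_lintegral_derivWithin_Icc_of_contDiffOn_Icc
        (contMDiffOn_iff_contDiffOn.1 he) zero_le_one
    _ ≤ ∫⁻ t in Icc (0 : ℝ) 1,
        C * ‖mfderivWithin 𝓘(ℝ, ℝ) (𝓡 n) γ (Icc 0 1) t 1‖ₑ := by
      refine MeasureTheory.setLIntegral_mono' measurableSet_Icc fun t ht => ?_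
      have h1 : mfderivWithin 𝓘(ℝ, ℝ) 𝓘(ℝ, EuclideanSpace ℝ (Fin n)) e (Icc 0 1) t =
          (mfderiv (𝓡 n) 𝓘(ℝ, EuclideanSpace ℝ (Fin n)) (extChartAt (𝓡 n) c) (γ t)) ∘L
            (mfderivWithin 𝓘(ℝ, ℝ) (𝓡 n) γ (Icc 0 1) t) := by
        refine mfderiv_comp_mfderivWithin _ (mdifferentiableAt_extChartAt (hsource t ht))
          (hγ.mdifferentiableOn one_ne_zero t ht) ?_
        rw [uniqueMDiffWithinAt_iff_uniqueDiffWithinAt]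
        exact uniqueDiffOn_Icc zero_lt_one t ht
      have h2 : derivWithin e (Icc 0 1) t = (trivializationAt (EuclideanSpace ℝ (Fin n))
          (fun x : M => TangentSpace (𝓡 n) x) c).continuousLinearMapAt ℝ (γ t)
            (mfderivWithin 𝓘(ℝ, ℝ) (𝓡 n) γ (Icc 0 1) t 1) := by
        rw [TangentBundle.continuousLinearMapAt_trivializationAt (hsource t ht),
          ← fderivWithin_derivWithin, ← mfderivWithin_eq_fderivWithin]
        exact congr($h1 1)
      rw [h2]
      refine (ContinuousLinearMap.le_opENorm _ _).trans ?_
      gcongr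
      exact hC t ht
    _ = C * pathELength (𝓡 n) γ 0 1 := by
      rw [MeasureTheory.lintegral_const_mul' _ _ ENNReal.coe_ne_top,
        pathELength_eq_lintegral_mfderivWithin_Icc]

variable [IsContMDiffRiemannianBundle (𝓡 n) ∞ (EuclideanSpace ℝ (Fin n))
      (fun x : M => TangentSpace (𝓡 n) x)]
    [IsRiemannianManifold (𝓡 n) M]

/-- Charts are locally Lipschitz for the Riemannian distance. -/
theorem exists_norm_extChartAt_sub_le (c : M) :
    ∃ K r : ℝ, 0 < K ∧ 0 < r ∧ ∀ x ∈ Metric.ball c r, ∀ x' ∈ Metric.ball c r,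
      ‖extChartAt (𝓡 n) c x' - extChartAt (𝓡 n) c x‖ ≤ K * dist x x' := by
  have := isContinuousRiemannianBundle_tangentSpace (n := n) (M := M)
  obtain ⟨C, hC, h⟩ := eventually_norm_trivializationAt_lt (EuclideanSpace ℝ (Fin n))
    (fun x : M => TangentSpace (𝓡 n) x) c
  obtain ⟨r, hr, hball⟩ := Metric.mem_nhds_iff.1
    (inter_mem h (chart_source_mem_nhds (EuclideanSpace ℝ (Fin n)) c))
  -- A path of length less than `2 * dist x x' < 4r/5` that starts in the ball of radius `r / 5`
  -- stays in the ball of radius `r`, where the chart derivative is bounded by `C`; the factor `2`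
  -- is the excess of the path over the distance.
  refine ⟨C * 2, r / 5, by positivity, by positivity, fun x hx x' hx' => ?_⟩
  rcases eq_or_ne x x' with rfl | hne
  · simp
  have hd : 0 < dist x x' := dist_pos.2 hne
  have hlt : edist x x' < ENNReal.ofReal (2 * dist x x') := by
    rw [edist_dist, ENNReal.ofReal_lt_ofReal_iff (by positivity)]
    linarith
  obtain ⟨γ, h0, h1, hγ, hlen⟩ := exists_path_pathELength_lt (n := n) hlt
  rw [Metric.mem_ball] at hx hx'
  have hxx : dist x x' < 2 * (r / 5) := by
    linarith [dist_triangle_right x x' c]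
  have hmem : ∀ s ∈ Icc (0 : ℝ) 1, γ s ∈ Metric.ball c r := by
    intro s hs
    have e1 : edist (γ 0) (γ s) < ENNReal.ofReal (2 * dist x x') :=
      (edist_le_pathELength hs.1 (hγ.mono (Icc_subset_Icc_right hs.2))).trans_lt
        ((pathELength_mono le_rfl hs.2).trans_lt hlen)
    rw [edist_dist, ENNReal.ofReal_lt_ofReal_iff (by positivity), h0] at e1
    rw [Metric.mem_ball]
    linarith [dist_triangle_left (γ s) c x]
  lift C to ℝ≥0 using hC.le
  have key := enorm_extChartAt_sub_le_pathELength (c := c) (C := C) hγ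
    (fun s hs => (hball (hmem s hs)).2) (fun s hs => by
      have := (hball (hmem s hs)).1
      simp only [enorm, nnnorm]
      exact_mod_cast (show ‖_‖ < (C : ℝ) from this).le)
  rw [h0, h1] at key
  have key2 := key.trans (mul_le_mul_right hlen.le (C : ℝ≥0∞))
  rw [← ofReal_norm, ← ENNReal.ofReal_coe_nnreal, ← ENNReal.ofReal_mul (by positivity),
    ENNReal.ofReal_le_ofReal_iff (by positivity)] at key2
  linarith

end ChartDistance

/-- Upper bounds for `u` propagate from `x` to `x'` whenever `x'` can be reached with speed `δ`. -/
def PropagatesUpperBounds {M : Type*} [Dist M] (u : M → ℝ → EReal) (Λ δ C : ℝ) (x x' : M) : Prop :=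
  ∀ t₁ t₂ A : ℝ, 0 < t₁ → t₁ < t₂ → dist x x' ≤ δ * (t₂ - t₁) → 0 ≤ A → u x t₁ ≤ (A : EReal) →
    u x' t₂ ≤ (((A + C) * Real.exp (Λ * (t₂ - t₁)) - C : ℝ) : EReal)

/-- The bound equals `A e^{Λτ} + C(e^{Λτ} - 1)`, which is nondecreasing in `C`. -/
theorem PropagatesUpperBounds.mono {M : Type*} [Dist M] {u : M → ℝ → EReal}
    {Λ δ C δ' C' : ℝ} {x x' : M} (h : PropagatesUpperBounds u Λ δ C x x') (hΛ : 0 < Λ)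
    (hδ : δ' ≤ δ) (hC : C ≤ C') : PropagatesUpperBounds u Λ δ' C' x x' := by
  intro t₁ t₂ A ht₁ ht hd hA hu
  have hτ : 0 < t₂ - t₁ := sub_pos.2 ht
  refine (h t₁ t₂ A ht₁ ht (hd.trans (by gcongr)) hA hu).trans ?_
  have h1 : 1 ≤ Real.exp (Λ * (t₂ - t₁)) := Real.one_le_exp (by positivity)
  have h2 : 0 ≤ (C' - C) * (Real.exp (Λ * (t₂ - t₁)) - 1) :=
    mul_nonneg (sub_nonneg.2 hC) (sub_nonneg.2 h1)
  exact_mod_cast (by linarith : (A + C) * Real.exp (Λ * (t₂ - t₁)) - C ≤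
    (A + C') * Real.exp (Λ * (t₂ - t₁)) - C')

/-! ### Uniform short-range propagation -/

section Step

variable {n : ℕ} {M : Type*} [MetricSpace M] [CompactSpace M]
    [ChartedSpace (EuclideanSpace ℝ (Fin n)) M] [IsManifold (𝓡 n) ∞ M]
    [Bundle.RiemannianBundle (fun x : M => TangentSpace (𝓡 n) x)]
    [IsContMDiffRiemannianBundle (𝓡 n) ∞ (EuclideanSpace ℝ (Fin n))
      (fun x : M => TangentSpace (𝓡 n) x)]
    [IsRiemannianManifold (𝓡 n) M]
    {H : CotangentBundle n M → ℝ → ℝ} {Λ : ℝ}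

theorem IsAdmissibleHamiltonian.exists_propagates_near (hH : IsAdmissibleHamiltonian H Λ) (c : M) :
    ∃ δ C r : ℝ, 0 < δ ∧ 0 < C ∧ 0 < r ∧ ∀ u : M → ℝ → EReal, IsLSCExtendedReal u →
      IsBJSubsolution H u → ∀ x ∈ Metric.ball c r, ∀ x' ∈ Metric.ball c r,
        PropagatesUpperBounds u Λ δ C x x' := by
  have hΛ := hH.lipschitz_pos
  obtain ⟨δ, B, hδ, hB⟩ := hH.exists_linear_le c
  obtain ⟨K, r₁, hK, hr₁, hKr⟩ := exists_norm_extChartAt_sub_le (n := n) c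
  have h1 : ∀ᶠ ζ in 𝓝 (extChartAt (𝓡 n) c c), ∀ (q : EuclideanSpace ℝ (Fin n) →L[ℝ] ℝ) (v : ℝ),
      δ * ‖q‖ - B - Λ * |v| ≤ H ⟨(extChartAt (𝓡 n) c).symm ζ,
        chartCovector c ((extChartAt (𝓡 n) c).symm ζ) q⟩ v := by
    have h := continuousAt_extChartAt_symm (I := 𝓡 n) c
    rw [ContinuousAt, extChartAt_to_inv] at h
    exact h.eventually hB
  obtain ⟨R, hR, hRs⟩ := Metric.nhds_basis_closedBall.mem_iff.1
    (inter_mem h1 (extChartAt_target_mem_nhds (I := 𝓡 n) c))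
  set ρ := min (R / 2) (δ / (Λ * 3)) with hρ
  have hρ0 : 0 < ρ := by positivity
  have hρR : 2 * ρ ≤ R := by linarith [min_le_left (R / 2) (δ / (Λ * 3))]
  have hρδ : Λ * (3 * ρ) ≤ δ := by
    have : ρ ≤ δ / (Λ * 3) := min_le_right _ _
    rw [le_div_iff₀ (by positivity)] at this
    linarith
  have hsub : Metric.closedBall (extChartAt (𝓡 n) c c) (2 * ρ) ⊆
      Metric.closedBall (extChartAt (𝓡 n) c c) R := Metric.closedBall_subset_closedBall hρR
  obtain ⟨r₂, hr₂, hr₂s⟩ := Metric.mem_nhds_iff.1 (inter_mem (extChartAt_source_mem_nhds (I := 𝓡 n) c)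
    ((continuousAt_extChartAt (I := 𝓡 n) c).preimage_mem_nhds (Metric.ball_mem_nhds _ hρ0)))
  -- The chart is `K`-Lipschitz and the segment lemma allows coordinate speed `δ / 2`; the second
  -- constant ensures `B < Λ * C`.
  refine ⟨δ / (2 * K), (|B| + 1) / Λ, min r₁ r₂, by positivity, by positivity, by positivity, ?_⟩
  intro u hu hsol x hx x' hx' t₁ t₂ A ht₁ ht hd hA huA
  have hx₂ := hr₂s (Metric.ball_subset_ball (min_le_right _ _) hx)
  have hx₂' := hr₂s (Metric.ball_subset_ball (min_le_right _ _) hx')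
  refine hsol.le_along_segment hu hΛ (δ := δ) (B := B) (by positivity) ?_ hρ0 hρδ
    (fun ζ hζ => (hRs (hsub hζ)).2) (fun z hz hz' => ?_) hx₂.1 hx₂'.1 hx₂.2 hx₂'.2 ht₁ ht ?_ hA huA
  · rw [mul_div_cancel₀ _ hΛ.ne']
    linarith [le_abs_self B]
  · have := (hRs (hsub hz')).1
    rwa [mem_ofPred_eq, (extChartAt (𝓡 n) c).left_inv hz] at this
  · refine (hKr x (Metric.ball_subset_ball (min_le_left _ _) hx) x'
      (Metric.ball_subset_ball (min_le_left _ _) hx')).trans ?_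
    calc K * dist x x' ≤ K * (δ / (2 * K) * (t₂ - t₁)) := by gcongr
      _ = δ / 2 * (t₂ - t₁) := by field_simp

/-- The radius is a Lebesgue number of a finite cover by the balls of `exists_propagates_near`; the
constants are the worst ones over this cover, which is nonempty because `M` is. -/
theorem IsAdmissibleHamiltonian.exists_propagates [Nonempty M] (hH : IsAdmissibleHamiltonian H Λ) :
    ∃ δ C r : ℝ, 0 < δ ∧ 0 < C ∧ 0 < r ∧ ∀ u : M → ℝ → EReal, IsLSCExtendedReal u →
      IsBJSubsolution H u → ∀ x x' : M, dist x x' < r → PropagatesUpperBounds u Λ δ C x x' := by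
  choose δ C r hδ hC hr h using hH.exists_propagates_near
  obtain ⟨S, hS⟩ := isCompact_univ.elim_nhds_subcover (fun c => Metric.ball c (r c))
    fun c _ => Metric.ball_mem_nhds c (hr c)
  obtain ⟨ρ, hρ, hLeb⟩ := lebesgue_number_lemma_of_metric (s := (univ : Set M)) isCompact_univ
    (c := fun c : S => Metric.ball (c : M) (r c)) (fun _ => Metric.isOpen_ball)
    (fun x hx => by
      obtain ⟨c, hc, hxc⟩ := mem_iUnion₂.1 (hS.2 hx)
      exact mem_iUnion.2 ⟨⟨c, hc⟩, hxc⟩)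
  obtain ⟨c₀, -⟩ := hLeb (Classical.arbitrary M) (mem_univ _)
  obtain ⟨c₁, -, hc₁⟩ := S.exists_min_image δ ⟨c₀, c₀.2⟩
  obtain ⟨c₂, -, hc₂⟩ := S.exists_max_image C ⟨c₀, c₀.2⟩
  refine ⟨δ c₁, C c₂, ρ, hδ _, hC _, hρ, fun u hu hsol x x' hd => ?_⟩
  obtain ⟨c, hc⟩ := hLeb x (mem_univ _)
  refine (h c u hu hsol x (hc (Metric.mem_ball_self hρ)) x' (hc ?_)).mono hH.lipschitz_pos
    (hc₁ c c.2) (hc₂ c c.2)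
  rwa [Metric.mem_ball']

end Step

/-! ### Long-range propagation by chains, and the conclusion -/

/-- Nearby points of a Riemannian manifold are joined by a chain of points with small steps
whose total length is at most twice the distance. -/
theorem exists_chain_sum_dist_le (n : ℕ) {M : Type*} [MetricSpace M]
    [ChartedSpace (EuclideanSpace ℝ (Fin n)) M]
    [Bundle.RiemannianBundle (fun x : M => TangentSpace (𝓡 n) x)]
    [IsRiemannianManifold (𝓡 n) M]
    {r : ℝ} (hr : 0 < r) (x y : M) :
    ∃ (N : ℕ) (p : ℕ → M), p 0 = x ∧ p N = y ∧ (∀ i < N, dist (p i) (p (i + 1)) < r) ∧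
      ∑ i ∈ Finset.range N, dist (p i) (p (i + 1)) ≤ 2 * dist x y := by
  rcases eq_or_ne x y with rfl | hne
  · exact ⟨0, fun _ => x, rfl, rfl, by simp, by simp⟩
  have hd : 0 < dist x y := dist_pos.2 hne
  have hlt : edist x y < ENNReal.ofReal (2 * dist x y) := by
    rw [edist_dist, ENNReal.ofReal_lt_ofReal_iff (by positivity)]
    linarith
  obtain ⟨γ, h0, h1, hγ, hlen⟩ := exists_path_pathELength_lt (n := n) hlt
  have huc : UniformContinuousOn γ (Icc 0 1) :=
    isCompact_Icc.uniformContinuousOn_of_continuous hγ.continuousOn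
  obtain ⟨η, hη, hγη⟩ := Metric.uniformContinuousOn_iff.1 huc r hr
  obtain ⟨N, hN⟩ := exists_nat_one_div_lt hη
  set m : ℕ := N + 1 with hm
  have hm0 : (0 : ℝ) < m := by positivity
  have hmem : ∀ i ≤ m, (i : ℝ) / m ∈ Icc (0 : ℝ) 1 := fun i hi =>
    ⟨by positivity, (div_le_one hm0).2 (by exact_mod_cast hi)⟩
  have hstep : ∀ i : ℕ, (i : ℝ) / m ≤ ((i + 1 : ℕ) : ℝ) / m := fun i => by
    gcongr; exact Nat.le_succ i
  have hsum : ∀ j ≤ m, ENNReal.ofReal (∑ i ∈ Finset.range j,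
      dist (γ ((i : ℝ) / m)) (γ (((i + 1 : ℕ) : ℝ) / m))) ≤ pathELength (𝓡 n) γ 0 ((j : ℝ) / m) := by
    intro j
    induction j with
    | zero => simp
    | succ j ih =>
      intro hj
      rw [Finset.sum_range_succ, ENNReal.ofReal_add (Finset.sum_nonneg fun _ _ => dist_nonneg)
        dist_nonneg, ← edist_dist, ← pathELength_add (hmem j (by omega)).1 (hstep j)]
      gcongr
      · exact ih (by omega)
      · exact edist_le_pathELength (hstep j)
          (hγ.mono (Icc_subset_Icc (hmem j (by omega)).1 (hmem (j + 1) hj).2))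
  refine ⟨m, fun i => γ ((i : ℝ) / m), by simp [h0], by simp [hm0.ne', h1], fun i hi => ?_, ?_⟩
  · refine hγη _ (hmem i hi.le) _ (hmem (i + 1) hi) ?_
    rw [Real.dist_eq, abs_sub_comm, ← sub_div, abs_of_nonneg (div_nonneg (by simp) hm0.le)]
    simpa [hm] using hN
  · have h2 := (hsum m le_rfl).trans_lt (by rwa [div_self hm0.ne'])
    rw [ENNReal.ofReal_lt_ofReal_iff (by positivity)] at h2
    exact h2.le

/-- Short-range propagation of upper bounds implies long-range propagation at half the speed. -/
theorem PropagatesUpperBounds.of_local (n : ℕ) {M : Type*} [MetricSpace M]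
    [ChartedSpace (EuclideanSpace ℝ (Fin n)) M]
    [Bundle.RiemannianBundle (fun x : M => TangentSpace (𝓡 n) x)]
    [IsRiemannianManifold (𝓡 n) M]
    {u : M → ℝ → EReal} {Λ δ C r : ℝ} (hΛ : 0 < Λ) (hδ : 0 < δ)
    (hC : 0 < C) (hr : 0 < r)
    (h : ∀ x x' : M, dist x x' < r → PropagatesUpperBounds u Λ δ C x x') (x x' : M) :
    PropagatesUpperBounds u Λ (δ / 2) C x x' := by
  intro t₁ t₂ A ht₁ ht hd hA huA
  obtain ⟨N, p, hp0, hpN, hpr, hsum⟩ := exists_chain_sum_dist_le n hr x x'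
  -- Each step of length `d` is given exactly the time `d / δ`, and any spare time is spent waiting
  -- at the initial point. The bounds compose because `A ↦ (A + C)e^{Λτ} - C` is a semigroup in `τ`.
  -- Steps of length zero are separate, as propagation needs a positive time.
  have key : ∀ j ≤ N, ∀ t, t₁ ≤ t → ∑ i ∈ Finset.range j, dist (p i) (p (i + 1)) ≤ δ * (t - t₁) →
      u (p j) t ≤ (((A + C) * Real.exp (Λ * (t - t₁)) - C : ℝ) : EReal) := by
    intro j
    induction j with
    | zero =>
      intro _ t htt _
      rcases htt.eq_or_lt with rfl | htt
      · simpa [hp0] using huA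
      rw [hp0]
      exact h x x (by simpa using hr) t₁ t A ht₁ htt
        (by rw [dist_self]; exact mul_nonneg hδ.le (by linarith)) hA huA
    | succ j ih =>
      intro hj t htt hs
      rw [Finset.sum_range_succ] at hs
      set d := dist (p j) (p (j + 1)) with hd_def
      have hS0 : 0 ≤ ∑ i ∈ Finset.range j, dist (p i) (p (i + 1)) :=
        Finset.sum_nonneg fun _ _ => dist_nonneg
      have hd0 : 0 ≤ d := dist_nonneg
      have hdd : δ * (d / δ) = d := by field_simp
      have ht' : t₁ ≤ t - d / δ := by
        have : d / δ ≤ t - t₁ := by rw [div_le_iff₀ hδ]; linarith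
        linarith
      have hj' := ih (by omega) (t - d / δ) ht' (by linarith)
      rcases hd0.eq_or_lt with hd0 | hd0
      · have e : p j = p (j + 1) := dist_eq_zero.1 (hd_def.symm.trans hd0.symm)
        rwa [← hd0, zero_div, sub_zero, e] at hj'
      have h1 : 1 ≤ Real.exp (Λ * (t - d / δ - t₁)) :=
        Real.one_le_exp (mul_nonneg hΛ.le (by linarith))
      have h2 : 0 ≤ (A + C) * Real.exp (Λ * (t - d / δ - t₁)) - C := by nlinarith
      have h3 := h (p j) (p (j + 1)) (hpr j (by omega)) (t - d / δ) t _ (by linarith)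
        (sub_lt_self t (by positivity)) (by rw [sub_sub_cancel, hdd]) h2 hj'
      rw [sub_add_cancel, mul_assoc, ← Real.exp_add] at h3
      convert h3 using 6
      ring
  rw [← hpN]
  exact key N le_rfl t₂ ht.le (by linarith)

theorem IsFundamentalSolution.upper_bound {n : ℕ} {M : Type*} [MetricSpace M]
    [ChartedSpace (EuclideanSpace ℝ (Fin n)) M] {H : CotangentBundle n M → ℝ → ℝ}
    {y : M} {h : M → ℝ → EReal} (hh : IsFundamentalSolution H y 0 h) {Λ δ C : ℝ} (hδ : 0 < δ)
    (hprop : ∀ x x' : M, PropagatesUpperBounds h Λ δ C x x') {x : M} {t : ℝ} (ht : 0 ≤ t)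
    (hxy : dist x y ≤ δ / 2 * t) : h x t ≤ ((C * (Real.exp (Λ * t) - 1) : ℝ) : EReal) := by
  rcases ht.eq_or_lt with rfl | ht
  · have : x = y := dist_le_zero.1 (by simpa using hxy)
    rw [hh.initial_value x, this]
    simp [pointDatum]
  have hlim : liminf (fun s : ℝ => h y s) (𝓝[>] (0 : ℝ)) = 0 := by
    rw [hh.initial_liminf y]
    simp [pointDatum]
  have hfreq : ∀ ε : ℝ, 0 < ε → ∃ᶠ s in 𝓝[>] (0 : ℝ),
      h x t ≤ (((ε + C) * Real.exp (Λ * (t - s)) - C : ℝ) : EReal) := by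
    intro ε hε
    have h1 : ∃ᶠ s in 𝓝[>] (0 : ℝ), h y s < (ε : EReal) := by
      refine frequently_lt_of_liminf_lt ?_ ?_
      · isBoundedDefault
      · rw [hlim]; exact_mod_cast hε
    -- Then `t - s ≥ t / 2`, so speed `δ` over the remaining time covers `δ / 2 * t`; this is where
    -- another factor `2` in the speed is lost.
    have h2 : ∀ᶠ s in 𝓝[>] (0 : ℝ), s < t / 2 :=
      nhdsWithin_le_nhds (gt_mem_nhds (by positivity))
    refine (h1.and_eventually (h2.and self_mem_nhdsWithin)).mono ?_
    rintro s ⟨hs1, hs2, hs3⟩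
    refine hprop y x s t ε hs3 (by linarith) ?_ hε.le hs1.le
    rw [dist_comm]
    nlinarith
  have hε : ∀ ε : ℝ, 0 < ε → h x t ≤ (((ε + C) * Real.exp (Λ * t) - C : ℝ) : EReal) := by
    intro ε hε
    have hc : Continuous fun s : ℝ =>
        (((ε + C) * Real.exp (Λ * (t - s)) - C : ℝ) : EReal) :=
      continuous_coe_real_ereal.comp (by fun_prop)
    have := (hc.tendsto 0).mono_left (nhdsWithin_le_nhds (s := Ioi (0 : ℝ)))
    rw [sub_zero] at this
    exact ge_of_tendsto_of_frequently this (hfreq ε hε)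
  have hc : Continuous fun ε : ℝ => (((ε + C) * Real.exp (Λ * t) - C : ℝ) : EReal) :=
    continuous_coe_real_ereal.comp (by fun_prop)
  have h3 := (hc.tendsto 0).mono_left (nhdsWithin_le_nhds (s := Ioi (0 : ℝ)))
  have h4 := ge_of_tendsto h3 (eventually_nhdsWithin_of_forall fun ε hε' => hε ε hε')
  convert h4 using 2
  ring

theorem proposition5p3 (n : ℕ) {M : Type*} [MetricSpace M] [CompactSpace M] [ConnectedSpace M]
    [ChartedSpace (EuclideanSpace ℝ (Fin n)) M] [IsManifold (𝓡 n) ∞ M]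
    [Bundle.RiemannianBundle (fun x : M => TangentSpace (𝓡 n) x)]
    [IsContMDiffRiemannianBundle (𝓡 n) ∞ (EuclideanSpace ℝ (Fin n))
      (fun x : M => TangentSpace (𝓡 n) x)]
    [IsRiemannianManifold (𝓡 n) M]
    (H : CotangentBundle n M → ℝ → ℝ) (Λ : ℝ) (hH : IsAdmissibleHamiltonian H Λ) :
    ∃ δ C : ℝ, 0 < δ ∧ 0 < C ∧
      ∀ (y : M) (h : M → ℝ → EReal), IsFundamentalSolution H y 0 h →
        ∀ (x : M) (t : ℝ), 0 ≤ t →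
          ((-(C * (Real.exp (Λ * t) - 1)) : ℝ) : EReal) ≤ h x t ∧
          (dist x y ≤ δ * t → h x t ≤ ((C * (Real.exp (Λ * t) - 1) : ℝ) : EReal)) := by
  have hΛ := hH.lipschitz_pos
  obtain ⟨B, hB, hHB⟩ := hH.exists_zero_le
  obtain ⟨δ, C, r, hδ, hC, hr, hprop⟩ := hH.exists_propagates
  -- One factor `2` in the speed comes from the chains, the other from the late start at the pole.
  -- The term `B / Λ` ensures `H(x,0,0) ≤ ΛC` for the lower bound.
  refine ⟨δ / 4, max C (B / Λ), by positivity, by positivity, fun y h hh x t ht => ?_⟩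
  refine ⟨?_, fun hxy => ?_⟩
  · refine hh.supersolution.lower_bound hh.lsc hΛ (by positivity) hH.lipschitz (fun z => ?_)
      (fun z => ?_) x ht
    · refine (hHB z).trans ?_
      calc B = Λ * (B / Λ) := by field_simp
        _ ≤ Λ * max C (B / Λ) := by gcongr; exact le_max_right _ _
    · rw [hh.initial_value z, pointDatum]
      split_ifs <;> simp
  · refine hh.upper_bound (δ := δ / 2) (by positivity) (fun z z' => ?_) ht (by linarith)
    exact (PropagatesUpperBounds.of_local n hΛ hδ hC hr (hprop h hh.lsc hh.subsolution)
      z z').mono hΛ le_rfl (le_max_left _ _)
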